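/- Let $\mathfrak H_1,\mathfrak H_2$ be complex Hilbert spaces and $\mathfrak H=\mathfrak H_1\oplus\mathfrak H_2$. Let linear operators $T^\circ_{11}\colon\operatorname{dom}T^\circ_{11}\to\mathfrak H_1$, $T^\circ_{12}\colon\operatorname{dom}T^\circ_{22}\to\mathfrak H_1$, $T^\circ_{21}\colon\operatorname{dom}T^\circ_{11}\to\mathfrak H_2$, $T^\circ_{22}\colon\operatorname{dom}T^\circ_{22}\to\mathfrak H_2$ (with $\operatorname{dom}T^\circ_{ii}\subseteq\mathfrak H_i$ linear subsets) be given such that the operator $$T^\circ=\begin{pmatrix}T^\circ_{11}&T^\circ_{12}\\T^\circ_{21}&T^\circ_{22}\end{pmatrix},\qquad \operatorname{dom}T^\circ=\operatorname{dom}T^\circ_{11}\oplus\operatorname{dom}T^\circ_{22},$$ is densely defined and symmetric in $\mathfrak H$, with $T^\circ_{11}$ bounded below and $T^\circ_{22}$ bounded above. *Angular extension.* For an injective bounded operator $I\colon\mathfrak D\to\mathfrak H$ with dense range from a Hilbert space $\mathfrak D$, let $\mathfrak D^*$ be the space of bounded conjugate-linear functionals on $\mathfrak D$ and $I^*\colon\mathfrak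 H\to\mathfrak D^*$, $(I^*f)(z)=\langle f,Iz\rangle$. To a symmetric operator $A$ in $\mathfrak H$ with $\operatorname{dom} A\subseteq I\mathfrak D$ associate the operator $(I^*)^{-1}\,\overline{I^*AI}\,I^{-1}$ in $\mathfrak H$, where $\overline{I^*AI}\colon\mathfrak D\to\mathfrak D^*$ is the closure of the operator $I^*AI$ with domain $I^{-1}\operatorname{dom}A$. Fix $\varkappa,\tau\in\mathbb R$ with $\langle(T^\circ_{11}-\varkappa)y,y\rangle\ge\|y\|^2$ for all $y\in\operatorname{dom}T^\circ_{11}$ and $\langle(\tau-T^\circ_{22})y,y\rangle\ge\|y\|^2$ for all $y\in\operatorname{dom}T^\circ_{22}$. Let $\mathfrak D_2$ be the completion of $\operatorname{dom}T^\circ_{22}$ in the norm $\langle(\tau-T^\circ_{22})y,y\rangle^{1/2}$, let $I_2\colon\mathfrak D_2\to\mathfrak H_2$ be the embedding, and let $T^\bullet_{22}$ be the Friedrichs extension of $T^\circ_{22}$, i.e. the operator associated as above with $I_2$ and $T^\circ_{22}$. Let $\mathfrak D_1$ be the completion of $\operatorname{dom}T^\circ_{11}$ in the norm $$\left[\langle(T^\circ_{11}-\varkappa)y,y\rangle+\langle(\tau-T^\bullet_{22})^{-1}T^\circ_{21}y,T^\circ_{21}y\rangle\right]^{1/2},$$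 with embedding $I_1\colon\mathfrak D_1\to\mathfrak H_1$, and put $\mathfrak D=\mathfrak D_1\oplus\mathfrak D_2$, $I=I_1\oplus I_2$. The angular extension $T^\bullet$ of $T^\circ$ is the operator associated as above with $I$ and $T^\circ$. *Proposition.* Suppose that $T^\circ$ is essentially self-adjoint and that at least one of the following conditions holds: 1. $T^\circ_{22}$ is essentially self-adjoint and, for some $\gamma,\varkappa'\in\mathbb R$, $\|T^\circ_{21}y\|^2\le\gamma\langle(T^\circ_{11}-\varkappa')y,y\rangle$ for all $y\in\operatorname{dom}T^\circ_{11}$; 2. for some $\gamma,\varkappa',\tau'\in\mathbb R$, $\|T^\circ_{21}y\|^2\le\gamma\langle(T^\circ_{11}-\varkappa')y,y\rangle$ for all $y\in\operatorname{dom}T^\circ_{11}$ and $\|T^\circ_{12}y\|^2\le\gamma\langle(\tau'-T^\circ_{22})y,y\rangle$ for all $y\in\operatorname{dom}T^\circ_{22}$; 3. $T^\circ_{11}$ and $T^\circ_{22}$ are bounded. Then, for every choice of $\varkappa,\tau$ as above, the closure of $T^\circ$ is the angular extension $T^\bullet$ of $T^\circ$. -/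

import Mathlib

open scoped InnerProductSpace ComplexConjugate

noncomputable section

/-! ### Completions with respect to a form -/

section FormCompletion

variable {H : Type*} [NormedAddCommGroup H] [InnerProductSpace ℂ H]

/-- A Hermitian sesquilinear form `s` (conjugate-linear in the first argument) on a linear subset
`p` of `H` whose quadratic form dominates the square of the norm of `H`. -/
structure IsCoerciveForm {p : Submodule ℂ H} (s : p →ₗ⋆[ℂ] p →ₗ[ℂ] ℂ) : Prop where
  hermitian : ∀ y z, conj (s z y) = s y z
  norm_sq_le : ∀ y : p, ‖(y : H)‖ ^ 2 ≤ (s y y).re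

/-- The linear set `p`, equipped with the inner product `s`
(so that the norm of `y` is `s y y ^ (1/2)`). -/
def FormSpace {p : Submodule ℂ H} (s : p →ₗ⋆[ℂ] p →ₗ[ℂ] ℂ) (_h : IsCoerciveForm s) : Type _ := p

namespace FormSpace

variable {p : Submodule ℂ H} {s : p →ₗ⋆[ℂ] p →ₗ[ℂ] ℂ} {h : IsCoerciveForm s}

instance : AddCommGroup (FormSpace s h) := inferInstanceAs (AddCommGroup p)
instance : Module ℂ (FormSpace s h) := inferInstanceAs (Module ℂ p)

instance instCore : InnerProductSpace.Core ℂ (FormSpace s h) where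
  inner y z := s y z
  conj_inner_symm y z := h.hermitian y z
  re_inner_nonneg y := (sq_nonneg _).trans (h.norm_sq_le y)
  add_left x y z := LinearMap.map_add₂ s x y z
  smul_left x y r := LinearMap.map_smulₛₗ₂ s r x y
  definite y hy := by
    have h1 := h.norm_sq_le y
    have h2 : (s y y).re = 0 := by
      change s y y = 0 at hy
      rw [hy]; rfl
    rw [h2] at h1
    have h3 : (((show p from y) : p) : H) = 0 := by
      rw [← norm_eq_zero]
      exact pow_eq_zero_iff (two_ne_zero) |>.1 (le_antisymm h1 (sq_nonneg _))
    exact Subtype.ext h3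

instance : NormedAddCommGroup (FormSpace s h) := instCore.toNormedAddCommGroup
instance : InnerProductSpace ℂ (FormSpace s h) := InnerProductSpace.ofCore _

theorem inner_def (y z : FormSpace s h) : ⟪y, z⟫_ℂ = s y z := rfl

/-- The inclusion of `p`, with the norm given by `s`, into `H`. -/
def incl (s : p →ₗ⋆[ℂ] p →ₗ[ℂ] ℂ) (h : IsCoerciveForm s) : FormSpace s h →L[ℂ] H :=
  LinearMap.mkContinuous (p.subtype : p →ₗ[ℂ] H) 1 (fun y => by
    rw [one_mul]
    refine le_of_sq_le_sq ?_ (norm_nonneg (E := FormSpace s h) y)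
    rw [@norm_sq_eq_re_inner ℂ (FormSpace s h)]
    exact h.norm_sq_le y)

end FormSpace

/-- The completion of `p` with respect to the norm `s y y ^ (1/2)`. -/
abbrev FormCompletion {p : Submodule ℂ H} (s : p →ₗ⋆[ℂ] p →ₗ[ℂ] ℂ) (h : IsCoerciveForm s) :
    Type _ :=
  UniformSpace.Completion (FormSpace s h)

namespace FormCompletion

variable {p : Submodule ℂ H} (s : p →ₗ⋆[ℂ] p →ₗ[ℂ] ℂ) (h : IsCoerciveForm s)

/-- The canonical map of `p` into its completion. -/
def ofDomain (y : p) : FormCompletion s h := ((show FormSpace s h from y) : FormCompletion s h)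

theorem inner_ofDomain (y z : p) : ⟪ofDomain s h y, ofDomain s h z⟫_ℂ = s y z :=
  UniformSpace.Completion.inner_coe (𝕜 := ℂ) (E := FormSpace s h) _ _

theorem induction_ofDomain {P : FormCompletion s h → Prop} (hP : IsClosed {y | P y})
    (hj : ∀ y : p, P (ofDomain s h y)) (y : FormCompletion s h) : P y :=
  UniformSpace.Completion.induction_on y hP hj

variable [CompleteSpace H]

/-- The embedding operator of the completion into `H`: the extension by continuity of the
inclusion of `p` into `H`. -/
def embed : FormCompletion s h →L[ℂ] H :=
  (FormSpace.incl s h).extend (UniformSpace.Completion.toComplL (𝕜 := ℂ) (E := FormSpace s h))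

@[simp] theorem embed_ofDomain (y : p) : embed s h (ofDomain s h y) = y :=
  ContinuousLinearMap.extend_eq _ UniformSpace.Completion.denseRange_coe
    (UniformSpace.Completion.isUniformInducing_coe _) _

theorem denseRange_embed (hp : Dense (p : Set H)) : DenseRange (embed s h) := by
  refine hp.mono ?_
  intro y hy
  exact ⟨ofDomain s h ⟨y, hy⟩, embed_ofDomain s h ⟨y, hy⟩⟩

end FormCompletion

end FormCompletion

/-! ### Operators in a rigging `D → H → D*` and the associated operators in `H` -/

section Rigging

variable {H D : Type*} [NormedAddCommGroup H] [InnerProductSpace ℂ H]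
  [NormedAddCommGroup D] [InnerProductSpace ℂ D]

/-- The space `D*` of bounded conjugate-linear functionals on `D`. -/
abbrev AntiDual (D : Type*) [NormedAddCommGroup D] [InnerProductSpace ℂ D] : Type _ := D →L⋆[ℂ] ℂ

/-- The operator `I* : H → D*` adjoint to an embedding `I : D → H`; `I* f` is the functional
`z ↦ ⟪I z, f⟫`. -/
def riggingAdjoint (I : D →L[ℂ] H) : H →L[ℂ] AntiDual D := ((innerSL ℂ).comp I).flip

@[simp] theorem riggingAdjoint_apply (I : D →L[ℂ] H) (f : H) (z : D) :
    riggingAdjoint I f z = ⟪I z, f⟫_ℂ := rfl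

/-- The operator `I* A I : D → D*`, with domain `I⁻¹ (dom A)`. -/
def riggedOperator (I : D →L[ℂ] H) (A : H →ₗ.[ℂ] H) : D →ₗ.[ℂ] AntiDual D where
  domain := A.domain.comap I.toLinearMap
  toFun :=
    { toFun := fun y => riggingAdjoint I (A ⟨I y, y.2⟩)
      map_add' := fun y z => by
        rw [← map_add, ← LinearPMap.map_add]
        congr 2
        exact Subtype.ext (map_add I (y : D) (z : D))
      map_smul' := fun c y => by
        rw [RingHom.id_apply, ← map_smul, ← LinearPMap.map_smul]
        congr 2
        exact Subtype.ext (map_smul I c (y : D)) }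

/-- The graph of `(I*)⁻¹ T I⁻¹`: the pairs `(x, f)` with `x = I y` and `T y = I* f` for some `y` in
the domain of `T`. -/
def bulletGraph (I : D →L[ℂ] H) (T : D →ₗ.[ℂ] AntiDual D) : Submodule ℂ (H × H) where
  carrier := {u | ∃ y : T.domain, I y = u.1 ∧ T y = riggingAdjoint I u.2}
  add_mem' := by
    rintro u v ⟨y, hy1, hy2⟩ ⟨z, hz1, hz2⟩
    exact ⟨y + z, by simp [hy1, hz1], by simp [LinearPMap.map_add, hy2, hz2]⟩
  zero_mem' := ⟨0, by simp, by simp⟩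
  smul_mem' := by
    rintro c u ⟨y, hy1, hy2⟩
    exact ⟨c • y, by simp [hy1], by simp [LinearPMap.map_smul, hy2]⟩

/-- The operator `T• = (I*)⁻¹ T I⁻¹` in `H` associated with an operator `T : D → D*`. -/
def bullet (I : D →L[ℂ] H) (T : D →ₗ.[ℂ] AntiDual D) : H →ₗ.[ℂ] H := (bulletGraph I T).toLinearPMap

theorem riggingAdjoint_injective {I : D →L[ℂ] H} (hd : DenseRange I) :
    Function.Injective (riggingAdjoint I) := by
  intro f g hfg
  refine Dense.eq_of_inner_right ℂ hd ?_
  rintro _ ⟨z, rfl⟩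
  exact congrArg (fun φ : AntiDual D => φ z) hfg

theorem mem_bullet_graph_iff {I : D →L[ℂ] H} (hI : Function.Injective I) (hd : DenseRange I)
    (T : D →ₗ.[ℂ] AntiDual D) (u : H × H) :
    u ∈ (bullet I T).graph ↔ ∃ y : T.domain, I y = u.1 ∧ T y = riggingAdjoint I u.2 := by
  rw [bullet, Submodule.toLinearPMap_graph_eq]
  · rfl
  · rintro u ⟨y, hy1, hy2⟩ hu
    have h0 : y = 0 := Subtype.ext (hI (by rw [hy1, hu]; simp))
    rw [h0, LinearPMap.map_zero] at hy2
    exact riggingAdjoint_injective hd (by rw [← hy2, map_zero])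

/-- The extension `(I*)⁻¹ T I⁻¹` of an operator `A` in `H`, where `T : D → D*` is the closure of
`I* A I`. -/
def riggedExtension (I : D →L[ℂ] H) (A : H →ₗ.[ℂ] H) : H →ₗ.[ℂ] H :=
  bullet I (riggedOperator I A).closure

end Rigging

/-! ### Symmetric and essentially self-adjoint operators -/

section Operators

variable {H : Type*} [NormedAddCommGroup H] [InnerProductSpace ℂ H]

/-- Densely defined symmetric operator. -/
def IsSymmetricOperator (A : H →ₗ.[ℂ] H) : Prop :=
  Dense (A.domain : Set H) ∧ A.IsFormalAdjoint A

/-- An operator is essentially self-adjoint if its closure is self-adjoint. -/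
def IsEssentiallySelfAdjoint [CompleteSpace H] (A : H →ₗ.[ℂ] H) : Prop :=
  IsSelfAdjoint A.closure

/-- `⟨A y, y⟩ ≥ m ‖y‖²` on the domain, for some real `m`. -/
def IsBoundedBelow (A : H →ₗ.[ℂ] H) : Prop :=
  ∃ m : ℝ, ∀ y : A.domain, m * ‖(y : H)‖ ^ 2 ≤ (⟪A y, (y : H)⟫_ℂ).re

/-- `⟨A y, y⟩ ≤ m ‖y‖²` on the domain, for some real `m`. -/
def IsBoundedAbove (A : H →ₗ.[ℂ] H) : Prop :=
  ∃ m : ℝ, ∀ y : A.domain, (⟪A y, (y : H)⟫_ℂ).re ≤ m * ‖(y : H)‖ ^ 2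

/-- `‖A y‖ ≤ C ‖y‖` on the domain, for some `C`. -/
def IsBoundedOperator (A : H →ₗ.[ℂ] H) : Prop :=
  ∃ C : ℝ, ∀ y : A.domain, ‖A y‖ ≤ C * ‖(y : H)‖

end Operators

/-! ### The Friedrichs extension of an operator bounded above -/

section Friedrichs

variable {H : Type*} [NormedAddCommGroup H] [InnerProductSpace ℂ H]

/-- `⟨(τ - A) y, y⟩ ≥ ‖y‖²` on the domain of `A`. -/
def IsUpperShift (A : H →ₗ.[ℂ] H) (τ : ℝ) : Prop :=
  ∀ y : A.domain, ‖(y : H)‖ ^ 2 ≤ (⟪(τ : ℂ) • (y : H) - A y, (y : H)⟫_ℂ).re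

/-- `⟨(A - ϰ) y, y⟩ ≥ ‖y‖²` on the domain of `A`. -/
def IsLowerShift (A : H →ₗ.[ℂ] H) (κ : ℝ) : Prop :=
  ∀ y : A.domain, ‖(y : H)‖ ^ 2 ≤ (⟪A y - (κ : ℂ) • (y : H), (y : H)⟫_ℂ).re

/-- The form `⟨(τ - A) y, z⟩` on the domain of `A`. -/
def upperForm (A : H →ₗ.[ℂ] H) (τ : ℝ) : A.domain →ₗ⋆[ℂ] A.domain →ₗ[ℂ] ℂ :=
  LinearMap.mk₂'ₛₗ (starRingEnd ℂ) (RingHom.id ℂ)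
    (fun y z => ⟪(τ : ℂ) • (y : H) - A y, (z : H)⟫_ℂ)
    (fun x y z => by
      simp only [Submodule.coe_add, LinearPMap.map_add, smul_add, inner_sub_left, inner_add_left]
      ring)
    (fun c y z => by
      simp only [Submodule.coe_smul, LinearPMap.map_smul, inner_sub_left, inner_smul_left,
        smul_eq_mul]
      ring)
    (fun x y z => by simp only [Submodule.coe_add, inner_add_right])
    (fun c y z => by simp only [Submodule.coe_smul, inner_smul_right, RingHom.id_apply, smul_eq_mul])

theorem upperForm_apply (A : H →ₗ.[ℂ] H) (τ : ℝ) (y z : A.domain) :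
    upperForm A τ y z = ⟪(τ : ℂ) • (y : H) - A y, (z : H)⟫_ℂ := rfl

theorem isCoerciveForm_upperForm {A : H →ₗ.[ℂ] H} {τ : ℝ} (hA : IsSymmetricOperator A)
    (hτ : IsUpperShift A τ) : IsCoerciveForm (upperForm A τ) where
  hermitian y z := by
    rw [upperForm_apply, upperForm_apply, inner_conj_symm, inner_sub_right, inner_sub_left,
      inner_smul_left, inner_smul_right, Complex.conj_ofReal, hA.2 y z]
  norm_sq_le := hτ

variable [CompleteSpace H] {A : H →ₗ.[ℂ] H} {τ : ℝ} (hA : IsSymmetricOperator A)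
  (hτ : IsUpperShift A τ)

/-- The completion of `dom A` with respect to the norm `⟨(τ - A) y, y⟩ ^ (1/2)`. -/
abbrev UpperEnergySpace (hA : IsSymmetricOperator A) (hτ : IsUpperShift A τ) : Type _ :=
  FormCompletion (upperForm A τ) (isCoerciveForm_upperForm hA hτ)

/-- The embedding of the energy space into `H`. -/
def upperEmbed : UpperEnergySpace hA hτ →L[ℂ] H :=
  FormCompletion.embed (upperForm A τ) (isCoerciveForm_upperForm hA hτ)

/-- The Friedrichs extension of the operator `A`. -/
def friedrichsExtension : H →ₗ.[ℂ] H := riggedExtension (upperEmbed hA hτ) A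

/-- The operator `I I†` in `H`, where `I` is the embedding of the energy space into `H` and `I†` is
its Hilbert space adjoint. It is the bounded inverse of `τ - A•`, where `A•` is the Friedrichs
extension of `A`: see `friedrichsResolvent_eq_inverse`. -/
def friedrichsResolvent : H →L[ℂ] H :=
  (upperEmbed hA hτ).comp (ContinuousLinearMap.adjoint (upperEmbed hA hτ))

theorem inner_ofDomain_upperEmbed (z : A.domain) (y : UpperEnergySpace hA hτ) :
    ⟪FormCompletion.ofDomain (upperForm A τ) (isCoerciveForm_upperForm hA hτ) z, y⟫_ℂ =
      ⟪(τ : ℂ) • (z : H) - A z, upperEmbed hA hτ y⟫_ℂ := by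
  refine FormCompletion.induction_ofDomain (P := fun y =>
    ⟪FormCompletion.ofDomain (upperForm A τ) (isCoerciveForm_upperForm hA hτ) z, y⟫_ℂ =
      ⟪(τ : ℂ) • (z : H) - A z, upperEmbed hA hτ y⟫_ℂ) _ _ ?_ (fun w => ?_) y
  · exact isClosed_eq (by fun_prop) (by fun_prop)
  · rw [FormCompletion.inner_ofDomain, upperForm_apply, upperEmbed, FormCompletion.embed_ofDomain]

theorem upperEmbed_injective : Function.Injective (upperEmbed hA hτ) := by
  refine (injective_iff_map_eq_zero _).2 fun y hy => ?_
  have h0 : ∀ x : UpperEnergySpace hA hτ, ⟪x, y⟫_ℂ = 0 := by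
    intro x
    refine FormCompletion.induction_ofDomain (P := fun x => ⟪x, y⟫_ℂ = 0) _ _ ?_
      (fun w => ?_) x
    · exact isClosed_eq (by fun_prop) (by fun_prop)
    · rw [inner_ofDomain_upperEmbed, hy, inner_zero_right]
  exact inner_self_eq_zero.1 (h0 y)

theorem upperEmbed_denseRange : DenseRange (upperEmbed hA hτ) :=
  FormCompletion.denseRange_embed _ _ hA.1

theorem closure_eq_toPMap {E F : Type*} [NormedAddCommGroup E] [NormedSpace ℂ E]
    [NormedAddCommGroup F] [NormedSpace ℂ F] (f : E →ₗ.[ℂ] F) (B : E →L[ℂ] F)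
    (hd : Dense (f.domain : Set E)) (hB : ∀ y : f.domain, f y = B y) :
    f.closure = B.toLinearMap.toPMap ⊤ := by
  have hgr : ∀ u : E × F, u ∈ (B.toLinearMap.toPMap ⊤).graph ↔ u.2 = B u.1 := by
    intro u
    rw [LinearPMap.mem_graph_iff]
    constructor
    · rintro ⟨y, h1, h2⟩
      rw [← h2, ← h1]; rfl
    · intro h
      exact ⟨⟨u.1, trivial⟩, rfl, h.symm⟩
  have hcl : (B.toLinearMap.toPMap ⊤).IsClosed := by
    have : ((B.toLinearMap.toPMap ⊤).graph : Set (E × F)) = {u | u.2 = B u.1} :=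
      Set.ext hgr
    rw [LinearPMap.IsClosed, this]
    exact isClosed_eq (by fun_prop) (by fun_prop)
  have hle : f ≤ B.toLinearMap.toPMap ⊤ :=
    ⟨le_top, fun x y hxy => by rw [hB x, hxy]; rfl⟩
  have hfc : f.IsClosable := hcl.isClosable.leIsClosable hle
  refine LinearPMap.eq_of_eq_graph (le_antisymm ?_ ?_)
  · rw [← hfc.graph_closure_eq_closure_graph]
    exact Submodule.topologicalClosure_minimal _ (LinearPMap.le_graph_of_le hle) hcl
  · intro u hu
    rw [hgr] at hu
    rw [← hfc.graph_closure_eq_closure_graph]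
    change u ∈ closure (f.graph : Set (E × F))
    have hmap : Set.MapsTo (fun x : E => (x, B x)) (f.domain : Set E) (f.graph : Set (E × F)) := by
      intro x hx
      have := f.mem_graph ⟨x, hx⟩
      rw [hB] at this
      exact this
    have hc : Continuous (fun x : E => (x, B x)) := by fun_prop
    have := map_mem_closure hc (hd u.1) hmap
    rw [← hu] at this
    exact this

theorem mem_friedrichsExtension_graph_iff (u : H × H) :
    u ∈ (friedrichsExtension hA hτ).graph ↔
      ∃ y : UpperEnergySpace hA hτ, upperEmbed hA hτ y = u.1 ∧
        ∀ z, (τ : ℂ) * ⟪upperEmbed hA hτ z, upperEmbed hA hτ y⟫_ℂ - ⟪z, y⟫_ℂ =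
          ⟪upperEmbed hA hτ z, u.2⟫_ℂ := by
  let I := upperEmbed hA hτ
  let B : UpperEnergySpace hA hτ →L[ℂ] AntiDual (UpperEnergySpace hA hτ) :=
    (τ : ℂ) • (riggingAdjoint I).comp I - (innerSL ℂ).flip
  have hBz : ∀ y z, B y z = (τ : ℂ) * ⟪I z, I y⟫_ℂ - ⟪z, y⟫_ℂ := fun y z => rfl
  have hcl : (riggedOperator I A).closure = B.toLinearMap.toPMap ⊤ := by
    refine closure_eq_toPMap _ _ ?_ ?_
    · intro x
      refine FormCompletion.induction_ofDomain _ _ isClosed_closure (fun w => ?_) x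
      refine subset_closure ?_
      change I _ ∈ A.domain
      rw [show I _ = (w : H) from FormCompletion.embed_ofDomain _ _ w]
      exact w.2
    · rintro ⟨y, hy⟩
      have hy' : I y ∈ A.domain := hy
      have hyj : y = FormCompletion.ofDomain (upperForm A τ) (isCoerciveForm_upperForm hA hτ)
          ⟨I y, hy'⟩ :=
        upperEmbed_injective hA hτ (FormCompletion.embed_ofDomain _ _ ⟨I y, hy'⟩).symm
      refine ContinuousLinearMap.ext fun z => ?_
      change ⟪I z, A ⟨I y, hy'⟩⟫_ℂ = B y z
      rw [hBz]
      have h1 := inner_ofDomain_upperEmbed hA hτ ⟨I y, hy'⟩ z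
      rw [← hyj] at h1
      have h2 : ⟪z, y⟫_ℂ = ⟪I z, (τ : ℂ) • I y - A ⟨I y, hy'⟩⟫_ℂ := by
        rw [← inner_conj_symm, h1, inner_conj_symm]
      rw [h2, inner_sub_right, inner_smul_right]
      ring
  rw [friedrichsExtension, riggedExtension,
    mem_bullet_graph_iff (upperEmbed_injective hA hτ) (upperEmbed_denseRange hA hτ)]
  change (∃ y : (riggedOperator I A).closure.domain, _) ↔ _
  rw [hcl]
  constructor
  · rintro ⟨y, h1, h2⟩
    refine ⟨y, h1, fun z => ?_⟩
    exact congrArg (fun φ : AntiDual (UpperEnergySpace hA hτ) => φ z) h2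
  · rintro ⟨y, h1, h2⟩
    exact ⟨⟨y, trivial⟩, h1, ContinuousLinearMap.ext h2⟩

/-- `friedrichsResolvent` is the (everywhere defined) inverse of `τ - A•`. -/
theorem friedrichsResolvent_eq_inverse :
    (∀ f : H, ∃ hf : friedrichsResolvent hA hτ f ∈ (friedrichsExtension hA hτ).domain,
      (τ : ℂ) • friedrichsResolvent hA hτ f -
        friedrichsExtension hA hτ ⟨friedrichsResolvent hA hτ f, hf⟩ = f) ∧
    ∀ x : (friedrichsExtension hA hτ).domain,
      friedrichsResolvent hA hτ ((τ : ℂ) • (x : H) - friedrichsExtension hA hτ x) = x := by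
  constructor
  · intro f
    have hm : (friedrichsResolvent hA hτ f, (τ : ℂ) • friedrichsResolvent hA hτ f - f) ∈
        (friedrichsExtension hA hτ).graph := by
      rw [mem_friedrichsExtension_graph_iff]
      refine ⟨ContinuousLinearMap.adjoint (upperEmbed hA hτ) f, rfl, fun z => ?_⟩
      rw [ContinuousLinearMap.adjoint_inner_right, inner_sub_right, inner_smul_right]
      rfl
    obtain ⟨y, h1, h2⟩ := (LinearPMap.mem_graph_iff _).1 hm
    have hf : friedrichsResolvent hA hτ f ∈ (friedrichsExtension hA hτ).domain := by
      have := y.2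
      rw [h1] at this
      exact this
    have hy : y = ⟨friedrichsResolvent hA hτ f, hf⟩ := Subtype.ext h1
    refine ⟨hf, ?_⟩
    rw [← hy, h2, sub_sub_cancel]
  · intro x
    obtain ⟨y, h1, h2⟩ :=
      (mem_friedrichsExtension_graph_iff hA hτ _).1 ((friedrichsExtension hA hτ).mem_graph x)
    dsimp only at h1 h2
    have hy : ContinuousLinearMap.adjoint (upperEmbed hA hτ)
        ((τ : ℂ) • (x : H) - friedrichsExtension hA hτ x) = y := by
      refine ext_inner_left ℂ fun z => ?_
      rw [ContinuousLinearMap.adjoint_inner_right, inner_sub_right, inner_smul_right, ← h2, ← h1]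
      ring
    rw [friedrichsResolvent, ContinuousLinearMap.comp_apply, hy, h1]

theorem inner_friedrichsResolvent (f g : H) :
    ⟪friedrichsResolvent hA hτ f, g⟫_ℂ =
      ⟪ContinuousLinearMap.adjoint (upperEmbed hA hτ) f,
        ContinuousLinearMap.adjoint (upperEmbed hA hτ) g⟫_ℂ := by
  rw [ContinuousLinearMap.adjoint_inner_right]; rfl

end Friedrichs

/-! ### Operator matrices and their angular extensions -/

section Matrix

/-- The entries of a `2 × 2` operator matrix: `T11 : dom T11 → H₁`, `T12 : dom T22 → H₁`,
`T21 : dom T11 → H₂`, `T22 : dom T22 → H₂`. -/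
structure OperatorMatrix (H₁ H₂ : Type*) [NormedAddCommGroup H₁] [InnerProductSpace ℂ H₁]
    [NormedAddCommGroup H₂] [InnerProductSpace ℂ H₂] where
  T11 : H₁ →ₗ.[ℂ] H₁
  T22 : H₂ →ₗ.[ℂ] H₂
  T12 : T22.domain →ₗ[ℂ] H₁
  T21 : T11.domain →ₗ[ℂ] H₂

namespace OperatorMatrix

variable {H₁ H₂ : Type*} [NormedAddCommGroup H₁] [InnerProductSpace ℂ H₁]
  [NormedAddCommGroup H₂] [InnerProductSpace ℂ H₂] (M : OperatorMatrix H₁ H₂)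

/-- The operator in the Hilbert sum `H₁ ⊕ H₂`, with domain `dom T11 ⊕ dom T22`, which takes
`(x, y)` to `(T11 x + T12 y, T21 x + T22 y)`. -/
def toOperator : WithLp 2 (H₁ × H₂) →ₗ.[ℂ] WithLp 2 (H₁ × H₂) where
  domain := (M.T11.domain.prod M.T22.domain).comap
    (WithLp.linearEquiv 2 ℂ (H₁ × H₂)).toLinearMap
  toFun :=
    { toFun := fun u => WithLp.toLp 2
        (M.T11 ⟨u.1.fst, u.2.1⟩ + M.T12 ⟨u.1.snd, u.2.2⟩,
          M.T21 ⟨u.1.fst, u.2.1⟩ + M.T22 ⟨u.1.snd, u.2.2⟩)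
      map_add' := fun u v => by
        have h1 : (⟨(u + v).1.fst, (u + v).2.1⟩ : M.T11.domain) =
          ⟨u.1.fst, u.2.1⟩ + ⟨v.1.fst, v.2.1⟩ := rfl
        have h2 : (⟨(u + v).1.snd, (u + v).2.2⟩ : M.T22.domain) =
          ⟨u.1.snd, u.2.2⟩ + ⟨v.1.snd, v.2.2⟩ := rfl
        rw [h1, h2, LinearPMap.map_add, LinearPMap.map_add, map_add, map_add, ← WithLp.toLp_add]
        congr 1
        exact Prod.ext (add_add_add_comm _ _ _ _) (add_add_add_comm _ _ _ _)
      map_smul' := fun c u => by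
        have h1 : (⟨(c • u).1.fst, (c • u).2.1⟩ : M.T11.domain) = c • ⟨u.1.fst, u.2.1⟩ := rfl
        have h2 : (⟨(c • u).1.snd, (c • u).2.2⟩ : M.T22.domain) = c • ⟨u.1.snd, u.2.2⟩ := rfl
        rw [h1, h2, LinearPMap.map_smul, LinearPMap.map_smul, map_smul, map_smul,
          RingHom.id_apply, ← WithLp.toLp_smul]
        congr 1
        exact Prod.ext (smul_add _ _ _).symm (smul_add _ _ _).symm }

/-- The matrix is symmetric: it defines a densely defined symmetric operator. -/
def IsSymmetric : Prop := IsSymmetricOperator M.toOperator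

variable {M}

theorem toOperator_toLp (x : M.T11.domain) (y : M.T22.domain)
    (h : WithLp.toLp 2 ((x : H₁), (y : H₂)) ∈ M.toOperator.domain) :
    M.toOperator ⟨WithLp.toLp 2 ((x : H₁), (y : H₂)), h⟩ =
      WithLp.toLp 2 (M.T11 x + M.T12 y, M.T21 x + M.T22 y) := rfl

theorem IsSymmetric.inner_eq (hM : M.IsSymmetric) (x x' : M.T11.domain) (y y' : M.T22.domain) :
    ⟪M.T11 x + M.T12 y, (x' : H₁)⟫_ℂ + ⟪M.T21 x + M.T22 y, (y' : H₂)⟫_ℂ =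
      ⟪(x : H₁), M.T11 x' + M.T12 y'⟫_ℂ + ⟪(y : H₂), M.T21 x' + M.T22 y'⟫_ℂ :=
  hM.2 ⟨WithLp.toLp 2 ((x : H₁), (y : H₂)), x.2, y.2⟩
    ⟨WithLp.toLp 2 ((x' : H₁), (y' : H₂)), x'.2, y'.2⟩

theorem IsSymmetric.T11 (hM : M.IsSymmetric) : IsSymmetricOperator M.T11 := by
  constructor
  · intro x
    have hc : Continuous (fun u : WithLp 2 (H₁ × H₂) => u.fst) := by fun_prop
    exact map_mem_closure hc (hM.1 (WithLp.toLp 2 (x, 0))) (fun u hu => hu.1)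
  · intro x y
    simpa using hM.inner_eq x y 0 0

theorem IsSymmetric.T22 (hM : M.IsSymmetric) : IsSymmetricOperator M.T22 := by
  constructor
  · intro x
    have hc : Continuous (fun u : WithLp 2 (H₁ × H₂) => u.snd) := by fun_prop
    exact map_mem_closure hc (hM.1 (WithLp.toLp 2 (0, x))) (fun u hu => hu.2)
  · intro x y
    simpa using hM.inner_eq 0 0 x y

theorem IsSymmetric.inner_T21 (hM : M.IsSymmetric) (x : M.T11.domain) (y : M.T22.domain) :
    ⟪M.T21 x, (y : H₂)⟫_ℂ = ⟪(x : H₁), M.T12 y⟫_ℂ := by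
  simpa using hM.inner_eq x 0 0 y

variable [CompleteSpace H₂] {κ τ : ℝ}

/-- The form `⟨(T11 - ϰ) y, z⟩ + ⟨(τ - T22•)⁻¹ T21 y, T21 z⟩` on the domain of `T11`. -/
def angularForm (hM : M.IsSymmetric) (κ : ℝ) (hτ : IsUpperShift M.T22 τ) :
    M.T11.domain →ₗ⋆[ℂ] M.T11.domain →ₗ[ℂ] ℂ :=
  LinearMap.mk₂'ₛₗ (starRingEnd ℂ) (RingHom.id ℂ)
    (fun y z => ⟪M.T11 y - (κ : ℂ) • (y : H₁), (z : H₁)⟫_ℂ +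
      ⟪friedrichsResolvent hM.T22 hτ (M.T21 y), M.T21 z⟫_ℂ)
    (fun x y z => by
      simp only [Submodule.coe_add, LinearPMap.map_add, map_add, smul_add, inner_sub_left,
        inner_add_left]
      ring)
    (fun c y z => by
      simp only [Submodule.coe_smul, LinearPMap.map_smul, map_smul, inner_sub_left,
        inner_smul_left, smul_eq_mul]
      ring)
    (fun x y z => by
      simp only [Submodule.coe_add, map_add, inner_add_right]
      ring)
    (fun c y z => by
      simp only [Submodule.coe_smul, map_smul, inner_smul_right, RingHom.id_apply, smul_eq_mul]
      ring)

theorem angularForm_apply (hM : M.IsSymmetric) (κ : ℝ) (hτ : IsUpperShift M.T22 τ)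
    (y z : M.T11.domain) :
    angularForm hM κ hτ y z = ⟪M.T11 y - (κ : ℂ) • (y : H₁), (z : H₁)⟫_ℂ +
      ⟪friedrichsResolvent hM.T22 hτ (M.T21 y), M.T21 z⟫_ℂ := rfl

theorem isCoerciveForm_angularForm (hM : M.IsSymmetric) (hκ : IsLowerShift M.T11 κ)
    (hτ : IsUpperShift M.T22 τ) : IsCoerciveForm (angularForm hM κ hτ) where
  hermitian y z := by
    rw [angularForm_apply, angularForm_apply, map_add, inner_conj_symm, inner_sub_right,
      inner_sub_left, inner_smul_left, inner_smul_right, Complex.conj_ofReal, hM.T11.2 y z,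
      inner_friedrichsResolvent, inner_conj_symm, inner_friedrichsResolvent]
  norm_sq_le y := by
    rw [angularForm_apply, Complex.add_re, inner_friedrichsResolvent]
    exact (hκ y).trans (le_add_of_nonneg_right (inner_self_nonneg (𝕜 := ℂ)))

/-- The space `D₁`: the completion of `dom T11` with respect to the norm
`[⟨(T11 - ϰ) y, y⟩ + ⟨(τ - T22•)⁻¹ T21 y, T21 y⟩] ^ (1/2)`. -/
abbrev AngularSpace₁ (hM : M.IsSymmetric) (hκ : IsLowerShift M.T11 κ)
    (hτ : IsUpperShift M.T22 τ) : Type _ :=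
  FormCompletion (angularForm hM κ hτ) (isCoerciveForm_angularForm hM hκ hτ)

/-- The space `D₂`: the completion of `dom T22` with respect to the norm
`⟨(τ - T22) y, y⟩ ^ (1/2)`. -/
abbrev AngularSpace₂ (hM : M.IsSymmetric) (hτ : IsUpperShift M.T22 τ) : Type _ :=
  UpperEnergySpace hM.T22 hτ

/-- The Hilbert sum `D = D₁ ⊕ D₂`. -/
abbrev AngularSpace (hM : M.IsSymmetric) (hκ : IsLowerShift M.T11 κ)
    (hτ : IsUpperShift M.T22 τ) : Type _ :=
  WithLp 2 (AngularSpace₁ hM hκ hτ × AngularSpace₂ hM hτ)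

variable [CompleteSpace H₁]

/-- The embedding `I₁ : D₁ → H₁`. -/
def angularEmbed₁ (hM : M.IsSymmetric) (hκ : IsLowerShift M.T11 κ) (hτ : IsUpperShift M.T22 τ) :
    AngularSpace₁ hM hκ hτ →L[ℂ] H₁ :=
  FormCompletion.embed (angularForm hM κ hτ) (isCoerciveForm_angularForm hM hκ hτ)

/-- The embedding `I = I₁ ⊕ I₂ : D → H₁ ⊕ H₂`. -/
def angularEmbed (hM : M.IsSymmetric) (hκ : IsLowerShift M.T11 κ) (hτ : IsUpperShift M.T22 τ) :
    AngularSpace hM hκ hτ →L[ℂ] WithLp 2 (H₁ × H₂) :=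
  (WithLp.prodContinuousLinearEquiv 2 ℂ H₁ H₂).symm.toContinuousLinearMap.comp
    (((angularEmbed₁ hM hκ hτ).prodMap (upperEmbed hM.T22 hτ)).comp
      (WithLp.prodContinuousLinearEquiv 2 ℂ (AngularSpace₁ hM hκ hτ)
        (AngularSpace₂ hM hτ)).toContinuousLinearMap)

/-- The angular extension `T• = (I*)⁻¹ T I⁻¹` of the operator matrix, where `T : D → D*` is the
closure of `I* T° I` and `T°` is the operator defined by the matrix. -/
def angularExtension (hM : M.IsSymmetric) (hκ : IsLowerShift M.T11 κ)
    (hτ : IsUpperShift M.T22 τ) : WithLp 2 (H₁ × H₂) →ₗ.[ℂ] WithLp 2 (H₁ × H₂) :=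
  riggedExtension (angularEmbed hM hκ hτ) M.toOperator

theorem angularEmbed_apply (hM : M.IsSymmetric) (hκ : IsLowerShift M.T11 κ)
    (hτ : IsUpperShift M.T22 τ) (u : AngularSpace hM hκ hτ) :
    angularEmbed hM hκ hτ u =
      WithLp.toLp 2 (angularEmbed₁ hM hκ hτ u.fst, upperEmbed hM.T22 hτ u.snd) := rfl

theorem angularEmbed₁_injective (hM : M.IsSymmetric) (hκ : IsLowerShift M.T11 κ)
    (hτ : IsUpperShift M.T22 τ) : Function.Injective (angularEmbed₁ hM hκ hτ) := by
  let S := FormSpace (angularForm hM κ hτ) (isCoerciveForm_angularForm hM hκ hτ)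
  let j := FormCompletion.ofDomain (angularForm hM κ hτ) (isCoerciveForm_angularForm hM hκ hτ)
  let J := ContinuousLinearMap.adjoint (upperEmbed hM.T22 hτ)
  have hbd : ∀ y : M.T11.domain, ‖J (M.T21 y)‖ ^ 2 ≤ (angularForm hM κ hτ y y).re := by
    intro y
    rw [angularForm_apply, Complex.add_re, inner_friedrichsResolvent,
      @norm_sq_eq_re_inner ℂ (AngularSpace₂ hM hτ)]
    exact le_add_of_nonneg_left ((sq_nonneg _).trans (hκ y))
  let K₀ : S →L[ℂ] AngularSpace₂ hM hτ :=
    LinearMap.mkContinuous (J.toLinearMap.comp M.T21 : M.T11.domain →ₗ[ℂ] _) 1 (fun y => by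
      rw [one_mul]
      refine le_of_sq_le_sq ?_ (norm_nonneg (E := S) y)
      rw [@norm_sq_eq_re_inner ℂ S]
      exact hbd y)
  let K : AngularSpace₁ hM hκ hτ →L[ℂ] AngularSpace₂ hM hτ :=
    K₀.extend (UniformSpace.Completion.toComplL (𝕜 := ℂ) (E := S))
  have hK : ∀ y, K (j y) = J (M.T21 y) := fun y =>
    ContinuousLinearMap.extend_eq _ UniformSpace.Completion.denseRange_coe
      (UniformSpace.Completion.isUniformInducing_coe _) _
  have hI : ∀ y, angularEmbed₁ hM hκ hτ (j y) = y := fun y => FormCompletion.embed_ofDomain _ _ y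
  have h1 : ∀ (w : M.T22.domain) (y : AngularSpace₁ hM hκ hτ),
      ⟪FormCompletion.ofDomain (upperForm M.T22 τ) (isCoerciveForm_upperForm hM.T22 hτ) w, K y⟫_ℂ =
        ⟪M.T12 w, angularEmbed₁ hM hκ hτ y⟫_ℂ := by
    intro w y
    refine FormCompletion.induction_ofDomain (P := fun y =>
      ⟪FormCompletion.ofDomain (upperForm M.T22 τ) (isCoerciveForm_upperForm hM.T22 hτ) w,
        K y⟫_ℂ = ⟪M.T12 w, angularEmbed₁ hM hκ hτ y⟫_ℂ) _ _ ?_ (fun x => ?_) y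
    · exact isClosed_eq (by fun_prop) (by fun_prop)
    · change ⟪_, K (j x)⟫_ℂ = ⟪_, angularEmbed₁ hM hκ hτ (j x)⟫_ℂ
      rw [hK, hI, ContinuousLinearMap.adjoint_inner_right, upperEmbed,
        FormCompletion.embed_ofDomain, ← inner_conj_symm, hM.inner_T21, inner_conj_symm]
  have h2 : ∀ (z : M.T11.domain) (y : AngularSpace₁ hM hκ hτ),
      ⟪j z, y⟫_ℂ = ⟪M.T11 z - (κ : ℂ) • (z : H₁), angularEmbed₁ hM hκ hτ y⟫_ℂ +
        ⟪J (M.T21 z), K y⟫_ℂ := by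
    intro z y
    refine FormCompletion.induction_ofDomain (P := fun y =>
      ⟪j z, y⟫_ℂ = ⟪M.T11 z - (κ : ℂ) • (z : H₁), angularEmbed₁ hM hκ hτ y⟫_ℂ +
        ⟪J (M.T21 z), K y⟫_ℂ) _ _ ?_ (fun x => ?_) y
    · exact isClosed_eq (by fun_prop) (by fun_prop)
    · change ⟪j z, j x⟫_ℂ = ⟪_, angularEmbed₁ hM hκ hτ (j x)⟫_ℂ + ⟪_, K (j x)⟫_ℂ
      rw [hK, hI, FormCompletion.inner_ofDomain, angularForm_apply, inner_friedrichsResolvent]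
  refine (injective_iff_map_eq_zero _).2 fun y hy => ?_
  have hKy : K y = 0 := by
    have h0 : ∀ x : AngularSpace₂ hM hτ, ⟪x, K y⟫_ℂ = 0 := by
      intro x
      refine FormCompletion.induction_ofDomain (P := fun x => ⟪x, K y⟫_ℂ = 0) _ _ ?_
        (fun w => ?_) x
      · exact isClosed_eq (by fun_prop) (by fun_prop)
      · rw [h1, hy, inner_zero_right]
    exact inner_self_eq_zero.1 (h0 _)
  have h0 : ∀ x : AngularSpace₁ hM hκ hτ, ⟪x, y⟫_ℂ = 0 := by
    intro x
    refine FormCompletion.induction_ofDomain (P := fun x => ⟪x, y⟫_ℂ = 0) _ _ ?_ (fun w => ?_) x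
    · exact isClosed_eq (by fun_prop) (by fun_prop)
    · change ⟪j w, y⟫_ℂ = 0
      rw [h2, hy, hKy, inner_zero_right, inner_zero_right, add_zero]
  exact inner_self_eq_zero.1 (h0 y)

theorem angularEmbed_injective (hM : M.IsSymmetric) (hκ : IsLowerShift M.T11 κ)
    (hτ : IsUpperShift M.T22 τ) : Function.Injective (angularEmbed hM hκ hτ) := by
  intro u v huv
  rw [angularEmbed_apply, angularEmbed_apply] at huv
  have h := Prod.ext_iff.1 (WithLp.toLp_injective 2 huv)
  exact WithLp.ofLp_injective 2 (Prod.ext (angularEmbed₁_injective hM hκ hτ h.1)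
    (upperEmbed_injective hM.T22 hτ h.2))

theorem angularEmbed_denseRange (hM : M.IsSymmetric) (hκ : IsLowerShift M.T11 κ)
    (hτ : IsUpperShift M.T22 τ) : DenseRange (angularEmbed hM hκ hτ) := by
  refine hM.1.mono ?_
  intro u hu
  refine ⟨WithLp.toLp 2 (FormCompletion.ofDomain _ _ ⟨u.fst, hu.1⟩,
    FormCompletion.ofDomain _ _ ⟨u.snd, hu.2⟩), ?_⟩
  have h1 : angularEmbed₁ hM hκ hτ (FormCompletion.ofDomain _ _ ⟨u.fst, hu.1⟩) = u.fst :=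
    FormCompletion.embed_ofDomain _ _ _
  have h2 : upperEmbed hM.T22 hτ (FormCompletion.ofDomain _ _ ⟨u.snd, hu.2⟩) = u.snd :=
    FormCompletion.embed_ofDomain _ _ _
  exact WithLp.ofLp_injective 2 (Prod.ext h1 h2)

/-- The angular extension as a single-valued operator: `T• x = f` exactly when `x = I y` and
`T y = I* f` for some `y`. -/
theorem mem_angularExtension_graph_iff (hM : M.IsSymmetric) (hκ : IsLowerShift M.T11 κ)
    (hτ : IsUpperShift M.T22 τ) (u : WithLp 2 (H₁ × H₂) × WithLp 2 (H₁ × H₂)) :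
    u ∈ (angularExtension hM hκ hτ).graph ↔
      ∃ y : (riggedOperator (angularEmbed hM hκ hτ) M.toOperator).closure.domain,
        angularEmbed hM hκ hτ y = u.1 ∧
          (riggedOperator (angularEmbed hM hκ hτ) M.toOperator).closure y =
            riggingAdjoint (angularEmbed hM hκ hτ) u.2 :=
  mem_bullet_graph_iff (angularEmbed_injective hM hκ hτ) (angularEmbed_denseRange hM hκ hτ) _ u

end OperatorMatrix

end Matrix

end

/-! The angular extension `T•` is a self-adjoint extension of `T°`, and an essentially self-adjoint
operator has only one self-adjoint extension, namely its closure
(`IsEssentiallySelfAdjoint.closure_eq`). The work lies in the self-adjointness of `T•`.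

The resolvent `(τ - T22•)⁻¹` is `I₂ I₂†`, so the second summand of the squared norm of `D₁` is `‖I₂†
T21 y‖²`. Hence `I₂† T21` extends to a contraction `K : D₁ → D₂` (`exists_coupling`). By the Riesz
identification of `D*` with `D`, and since the inner products of `D₁` and `D₂` are built from `T11 -
ϰ` and `τ - T22`, the operator `I* T° I` is the restriction to a dense set of the bounded symmetric
block operator with rows `(ϰ I₁†I₁ + 1 - K†K, K†)` and `(K, τ I₂†I₂ - 1)` (`inner_toOperator_eq`).
Its closure is therefore everywhere defined, and `T•` is symmetric and extends `T°`.

Subtracting `ϰ ⊕ τ` leaves the rows `(1 - K†K, K†)` and `(K, -1)`. The Schur complement of the lower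
right entry is `(1 - K†K) + K†K = 1`, so the system can be solved explicitly for every right-hand
side (`surjective_angularExtension_sub`). A symmetric operator that becomes surjective after
subtraction of a bounded symmetric one is self-adjoint (`adjoint_eq_of_surjective_sub`). -/

noncomputable section

/-! ### Criteria for self-adjointness and uniqueness of self-adjoint extensions. -/

section SelfAdjointExtension

variable {H : Type*} [NormedAddCommGroup H] [InnerProductSpace ℂ H] [CompleteSpace H]

/-- A symmetric operator `B` is self-adjoint as soon as `B - S` is surjective for some bounded
symmetric `S`. -/
theorem adjoint_eq_of_surjective_sub {B : H →ₗ.[ℂ] H} (hB : IsSymmetricOperator B)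
    (S : H →L[ℂ] H) (hS : ∀ x y, ⟪S x, y⟫_ℂ = ⟪x, S y⟫_ℂ)
    (hsurj : ∀ a, ∃ x : B.domain, B x = a + S x) : B.adjoint = B := by
  refine le_antisymm ?_ (hB.2.le_adjoint hB.1)
  have hadj := B.adjoint_isFormalAdjoint hB.1
  refine LinearPMap.le_of_le_graph fun u hu => ?_
  obtain ⟨x, hx1, hx2⟩ := (LinearPMap.mem_graph_iff _).1 hu
  -- Chosen so that `(B - S) y` equals `(B† - S) u.1`. The difference `u.1 - y` is then annihilated
  -- by `B† - S`, hence orthogonal to the range of `B - S`, which is the whole space.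
  obtain ⟨y, hy⟩ := hsurj (u.2 - S u.1)
  have hv : u.1 - (y : H) = 0 := by
    refine ext_inner_right ℂ fun a => ?_
    obtain ⟨z, hz⟩ := hsurj a
    have h1 := hadj x z
    have h2 := hB.2 y z
    rw [hx1, hx2, hz, inner_add_right, ← hS] at h1
    rw [hy, hz, inner_add_right, ← hS, inner_add_left, inner_sub_left] at h2
    rw [inner_sub_left, inner_zero_left]
    linear_combination h2 - h1
  rw [sub_eq_zero] at hv
  rw [hv, sub_add_cancel] at hy
  exact (LinearPMap.mem_graph_iff _).2 ⟨y, hv.symm, hy⟩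

/-- The closure of an essentially self-adjoint operator is its only self-adjoint extension. -/
theorem IsEssentiallySelfAdjoint.closure_eq {A B : H →ₗ.[ℂ] H} (hA : IsEssentiallySelfAdjoint A)
    (hAB : A ≤ B) (hd : Dense (B.domain : Set H)) (hB : B.adjoint = B) : A.closure = B := by
  have hBc : B.IsClosed := by
    rw [← hB]
    exact LinearPMap.adjoint_isClosed hd
  have hle : A.closure ≤ B := by
    have hAc : A.IsClosable := hBc.isClosable.leIsClosable hAB
    refine LinearPMap.le_of_le_graph ?_
    rw [← hAc.graph_closure_eq_closure_graph]
    exact Submodule.topologicalClosure_minimal _ (LinearPMap.le_graph_of_le hAB) hBc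
  refine le_antisymm hle ?_
  -- For the reverse inclusion, adjoints reverse order: `A.closure ≤ B` gives `B = B† ≤ A.closure† =
  -- A.closure`.
  have hfa : B.IsFormalAdjoint B := by
    have := B.adjoint_isFormalAdjoint hd
    rwa [hB] at this
  have hfa' : A.closure.IsFormalAdjoint B := by
    intro x y
    have h := hfa ⟨x, hle.1 x.2⟩ y
    rwa [← hle.2 (x := x) (y := ⟨x, hle.1 x.2⟩) rfl] at h
  have h := hfa'.le_adjoint hA.dense_domain
  rwa [(LinearPMap.isSelfAdjoint_def.1 hA)] at h

end SelfAdjointExtension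

/-! ### Operators whose rigged form is bounded. -/

section BoundedRiggedOperator

variable {H D : Type*} [NormedAddCommGroup H] [InnerProductSpace ℂ H]
  [NormedAddCommGroup D] [InnerProductSpace ℂ D] {I : D →L[ℂ] H} {A : H →ₗ.[ℂ] H}

/-- The graph of the extension of `A`, when `I* A I` is densely defined and given by a bounded
operator `Ψ` in `D`. -/
theorem mem_riggedExtension_graph_iff (hI : Function.Injective I) (hd : DenseRange I)
    (Ψ : D →L[ℂ] D) (hdom : Dense (A.domain.comap I.toLinearMap : Set D))
    (hΨ : ∀ (y : D) (hy : I y ∈ A.domain) (z : D), ⟪I z, A ⟨I y, hy⟩⟫_ℂ = ⟪z, Ψ y⟫_ℂ)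
    (u : H × H) :
    u ∈ (riggedExtension I A).graph ↔
      ∃ y : D, I y = u.1 ∧ ∀ z, ⟪z, Ψ y⟫_ℂ = ⟪I z, u.2⟫_ℂ := by
  -- A densely defined bounded operator has an everywhere defined closure; `(innerSL ℂ).flip` is the
  -- Riesz map from `D` to `D*`.
  have hcl : (riggedOperator I A).closure =
      ((innerSL ℂ).flip.comp Ψ : D →L[ℂ] AntiDual D).toLinearMap.toPMap ⊤ :=
    closure_eq_toPMap _ _ hdom fun y => ContinuousLinearMap.ext fun z => hΨ y y.2 z
  rw [riggedExtension, mem_bullet_graph_iff hI hd, hcl]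
  constructor
  · rintro ⟨y, h1, h2⟩
    exact ⟨y, h1, fun z => congrArg (fun φ : AntiDual D => φ z) h2⟩
  · rintro ⟨y, h1, h2⟩
    exact ⟨⟨y, trivial⟩, h1, ContinuousLinearMap.ext h2⟩

end BoundedRiggedOperator

/-! ### The shift `ϰ ⊕ τ`, the canonical maps and the coupling operator `K`. -/

namespace OperatorMatrix

variable {H₁ H₂ : Type*} [NormedAddCommGroup H₁] [InnerProductSpace ℂ H₁]
  [NormedAddCommGroup H₂] [InnerProductSpace ℂ H₂]

/-- The bounded operator `ϰ ⊕ τ` in `H₁ ⊕ H₂`. -/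
def diagonalShift (H₁ H₂ : Type*) [NormedAddCommGroup H₁] [InnerProductSpace ℂ H₁]
    [NormedAddCommGroup H₂] [InnerProductSpace ℂ H₂] (κ τ : ℝ) :
    WithLp 2 (H₁ × H₂) →L[ℂ] WithLp 2 (H₁ × H₂) :=
  (WithLp.prodContinuousLinearEquiv 2 ℂ H₁ H₂).symm.toContinuousLinearMap.comp
    (((κ : ℂ) • WithLp.fstL 2 ℂ H₁ H₂).prod ((τ : ℂ) • WithLp.sndL 2 ℂ H₁ H₂))

theorem inner_diagonalShift (κ τ : ℝ) (u v : WithLp 2 (H₁ × H₂)) :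
    ⟪u, diagonalShift H₁ H₂ κ τ v⟫_ℂ = κ * ⟪u.fst, v.fst⟫_ℂ + τ * ⟪u.snd, v.snd⟫_ℂ := by
  rw [← inner_smul_right, ← inner_smul_right]
  exact WithLp.prod_inner_apply _ _

theorem diagonalShift_symm (κ τ : ℝ) (u v : WithLp 2 (H₁ × H₂)) :
    ⟪diagonalShift H₁ H₂ κ τ u, v⟫_ℂ = ⟪u, diagonalShift H₁ H₂ κ τ v⟫_ℂ := by
  rw [← inner_conj_symm, inner_diagonalShift, inner_diagonalShift]
  simp only [map_add, map_mul, Complex.conj_ofReal, inner_conj_symm]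

variable {M : OperatorMatrix H₁ H₂} {κ τ : ℝ} [CompleteSpace H₂]

/-- The canonical map `dom T11 → D₁`. -/
def ofDomain₁ (hM : M.IsSymmetric) (hκ : IsLowerShift M.T11 κ) (hτ : IsUpperShift M.T22 τ)
    (x : M.T11.domain) : AngularSpace₁ hM hκ hτ :=
  FormCompletion.ofDomain (angularForm hM κ hτ) (isCoerciveForm_angularForm hM hκ hτ) x

/-- The canonical map `dom T22 → D₂`. -/
def ofDomain₂ (hM : M.IsSymmetric) (hτ : IsUpperShift M.T22 τ) (w : M.T22.domain) :
    AngularSpace₂ hM hτ :=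
  FormCompletion.ofDomain (upperForm M.T22 τ) (isCoerciveForm_upperForm hM.T22 hτ) w

/-- The operator `K` agrees with `I₂† T21` on `dom T11`. -/
def IsCoupling {hM : M.IsSymmetric} {hκ : IsLowerShift M.T11 κ} {hτ : IsUpperShift M.T22 τ}
    (K : AngularSpace₁ hM hκ hτ →L[ℂ] AngularSpace₂ hM hτ) : Prop :=
  ∀ y, K (ofDomain₁ hM hκ hτ y) = ContinuousLinearMap.adjoint (upperEmbed hM.T22 hτ) (M.T21 y)

/-- The operator `D₁ → D₂` which represents `T21`: the extension by continuity of
`y ↦ I₂† T21 y`. -/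
theorem exists_coupling (hM : M.IsSymmetric) (hκ : IsLowerShift M.T11 κ)
    (hτ : IsUpperShift M.T22 τ) :
    ∃ K : AngularSpace₁ hM hκ hτ →L[ℂ] AngularSpace₂ hM hτ, IsCoupling K := by
  let S := FormSpace (angularForm hM κ hτ) (isCoerciveForm_angularForm hM hκ hτ)
  let J := ContinuousLinearMap.adjoint (upperEmbed hM.T22 hτ)
  -- The left side is exactly the resolvent term of the form, and the other term is nonnegative;
  -- this makes the extension a contraction.
  have hbd : ∀ y : M.T11.domain, ‖J (M.T21 y)‖ ^ 2 ≤ (angularForm hM κ hτ y y).re := by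
    intro y
    rw [angularForm_apply, Complex.add_re, inner_friedrichsResolvent,
      @norm_sq_eq_re_inner ℂ (AngularSpace₂ hM hτ)]
    exact le_add_of_nonneg_left ((sq_nonneg _).trans (hκ y))
  let K₀ : S →L[ℂ] AngularSpace₂ hM hτ :=
    LinearMap.mkContinuous (J.toLinearMap.comp M.T21 : M.T11.domain →ₗ[ℂ] _) 1 (fun y => by
      rw [one_mul]
      refine le_of_sq_le_sq ?_ (norm_nonneg (E := S) y)
      rw [@norm_sq_eq_re_inner ℂ S]
      exact hbd y)
  exact ⟨K₀.extend (UniformSpace.Completion.toComplL (𝕜 := ℂ) (E := S)), fun y =>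
    ContinuousLinearMap.extend_eq _ UniformSpace.Completion.denseRange_coe
      (UniformSpace.Completion.isUniformInducing_coe _) _⟩

/-! ### The bounded block operator in `D` representing `T°`. -/

section Coupling

variable {hM : M.IsSymmetric} {hκ : IsLowerShift M.T11 κ} {hτ : IsUpperShift M.T22 τ}
  {K : AngularSpace₁ hM hκ hτ →L[ℂ] AngularSpace₂ hM hτ}

theorem upperEmbed_ofDomain₂ (w : M.T22.domain) :
    upperEmbed hM.T22 hτ (ofDomain₂ hM hτ w) = w :=
  FormCompletion.embed_ofDomain _ _ w

/-- The diagonal entry `T22` in terms of the inner product of `D₂`. -/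
theorem inner_T22_eq (w : M.T22.domain) (y : AngularSpace₂ hM hτ) :
    ⟪upperEmbed hM.T22 hτ y, M.T22 w⟫_ℂ =
      τ * ⟪upperEmbed hM.T22 hτ y, (w : H₂)⟫_ℂ - ⟪y, ofDomain₂ hM hτ w⟫_ℂ := by
  have h : ⟪ofDomain₂ hM hτ w, y⟫_ℂ = _ := inner_ofDomain_upperEmbed hM.T22 hτ w y
  rw [← inner_conj_symm y, h, inner_conj_symm, inner_sub_right, inner_smul_right]
  ring

variable [CompleteSpace H₁]

theorem angularEmbed₁_ofDomain₁ (x : M.T11.domain) :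
    angularEmbed₁ hM hκ hτ (ofDomain₁ hM hκ hτ x) = x :=
  FormCompletion.embed_ofDomain _ _ x

/-- `K` represents `T12` as well. -/
theorem inner_T12_eq (hK : IsCoupling K) (w : M.T22.domain) (y : AngularSpace₁ hM hκ hτ) :
    ⟪angularEmbed₁ hM hκ hτ y, M.T12 w⟫_ℂ = ⟪K y, ofDomain₂ hM hτ w⟫_ℂ := by
  refine FormCompletion.induction_ofDomain (P := fun y =>
    ⟪angularEmbed₁ hM hκ hτ y, M.T12 w⟫_ℂ = ⟪K y, ofDomain₂ hM hτ w⟫_ℂ) _ _ ?_ (fun x => ?_) y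
  · exact isClosed_eq (by fun_prop) (by fun_prop)
  · change ⟪angularEmbed₁ hM hκ hτ (ofDomain₁ hM hκ hτ x), _⟫_ℂ =
      ⟪K (ofDomain₁ hM hκ hτ x), _⟫_ℂ
    -- On `dom T11` the adjoint `I₂†` is moved to the other side, and the symmetry of `T°` exchanges
    -- `T21` for `T12`.
    rw [hK x, angularEmbed₁_ofDomain₁, ContinuousLinearMap.adjoint_inner_left,
      upperEmbed_ofDomain₂, hM.inner_T21]

/-- The diagonal entry `T11` in terms of the inner product of `D₁`. -/
theorem inner_T11_eq (hK : IsCoupling K) (x : M.T11.domain) (y : AngularSpace₁ hM hκ hτ) :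
    ⟪angularEmbed₁ hM hκ hτ y, M.T11 x⟫_ℂ = κ * ⟪angularEmbed₁ hM hκ hτ y, (x : H₁)⟫_ℂ +
      ⟪y, ofDomain₁ hM hκ hτ x⟫_ℂ - ⟪K y, K (ofDomain₁ hM hκ hτ x)⟫_ℂ := by
  refine FormCompletion.induction_ofDomain (P := fun y =>
    ⟪angularEmbed₁ hM hκ hτ y, M.T11 x⟫_ℂ = κ * ⟪angularEmbed₁ hM hκ hτ y, (x : H₁)⟫_ℂ +
      ⟪y, ofDomain₁ hM hκ hτ x⟫_ℂ - ⟪K y, K (ofDomain₁ hM hκ hτ x)⟫_ℂ) _ _ ?_ (fun z => ?_) y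
  · exact isClosed_eq (by fun_prop) (by fun_prop)
  · change ⟪angularEmbed₁ hM hκ hτ (ofDomain₁ hM hκ hτ z), _⟫_ℂ =
      κ * ⟪angularEmbed₁ hM hκ hτ (ofDomain₁ hM hκ hτ z), _⟫_ℂ +
      ⟪ofDomain₁ hM hκ hτ z, ofDomain₁ hM hκ hτ x⟫_ℂ - ⟪K (ofDomain₁ hM hκ hτ z), _⟫_ℂ
    have h : ⟪ofDomain₁ hM hκ hτ z, ofDomain₁ hM hκ hτ x⟫_ℂ = angularForm hM κ hτ z x :=
      FormCompletion.inner_ofDomain _ _ z x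
    -- The resolvent term in the inner product of `D₁` is `⟪K z, K x⟫`, so it cancels and `T11 - ϰ`
    -- remains.
    rw [h, hK z, hK x, angularEmbed₁_ofDomain₁, angularForm_apply, inner_friedrichsResolvent,
      inner_sub_left, inner_smul_left, Complex.conj_ofReal, hM.T11.2 z x]
    ring

variable (K) in
/-- The bounded operator in `D` which represents `I* T° I`. -/
def angularOperator : AngularSpace hM hκ hτ →L[ℂ] AngularSpace hM hκ hτ :=
  let I₁ := angularEmbed₁ hM hκ hτ
  let I₂ := upperEmbed hM.T22 hτ
  let P₁ := WithLp.fstL 2 ℂ (AngularSpace₁ hM hκ hτ) (AngularSpace₂ hM hτ)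
  let P₂ := WithLp.sndL 2 ℂ (AngularSpace₁ hM hκ hτ) (AngularSpace₂ hM hτ)
  (WithLp.prodContinuousLinearEquiv 2 ℂ (AngularSpace₁ hM hκ hτ)
      (AngularSpace₂ hM hτ)).symm.toContinuousLinearMap.comp
    -- The inner product of `D₁` is the form of `T11 - ϰ` plus that of `K†K`, and the inner product
    -- of `D₂` is the form of `τ - T22`; solving for `T11` and `T22` gives the diagonal entries.
    ((((κ : ℂ) • (I₁.adjoint.comp I₁) + .id ℂ _ - K.adjoint.comp K).comp P₁ +
        K.adjoint.comp P₂).prod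
      (K.comp P₁ + ((τ : ℂ) • (I₂.adjoint.comp I₂) - .id ℂ _).comp P₂))

theorem inner_angularOperator (z y : AngularSpace hM hκ hτ) :
    ⟪z, angularOperator K y⟫_ℂ =
      κ * ⟪angularEmbed₁ hM hκ hτ z.fst, angularEmbed₁ hM hκ hτ y.fst⟫_ℂ + ⟪z.fst, y.fst⟫_ℂ
        - ⟪K z.fst, K y.fst⟫_ℂ + ⟪K z.fst, y.snd⟫_ℂ +
      (⟪z.snd, K y.fst⟫_ℂ +
        (τ * ⟪upperEmbed hM.T22 hτ z.snd, upperEmbed hM.T22 hτ y.snd⟫_ℂ - ⟪z.snd, y.snd⟫_ℂ)) := by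
  have h : angularOperator K y = WithLp.toLp 2
      ((κ : ℂ) • (angularEmbed₁ hM hκ hτ).adjoint (angularEmbed₁ hM hκ hτ y.fst) + y.fst -
          K.adjoint (K y.fst) + K.adjoint y.snd,
        K y.fst + ((τ : ℂ) • (upperEmbed hM.T22 hτ).adjoint (upperEmbed hM.T22 hτ y.snd) -
          y.snd)) := rfl
  rw [h, WithLp.prod_inner_apply]
  simp only [inner_add_right, inner_sub_right, inner_smul_right,
    ContinuousLinearMap.adjoint_inner_right]
  rfl

theorem angularOperator_symm (z y : AngularSpace hM hκ hτ) :
    ⟪angularOperator K z, y⟫_ℂ = ⟪z, angularOperator K y⟫_ℂ := by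
  rw [← inner_conj_symm, inner_angularOperator, inner_angularOperator]
  simp only [map_add, map_sub, map_mul, Complex.conj_ofReal, inner_conj_symm]
  ring

theorem angularEmbed_toLp (x : M.T11.domain) (w : M.T22.domain) :
    angularEmbed hM hκ hτ (WithLp.toLp 2 (ofDomain₁ hM hκ hτ x, ofDomain₂ hM hτ w)) =
      WithLp.toLp 2 ((x : H₁), (w : H₂)) :=
  WithLp.ofLp_injective 2 (Prod.ext (angularEmbed₁_ofDomain₁ _) (upperEmbed_ofDomain₂ (hM := hM) _))

variable (hM hκ hτ) in
-- Injectivity of `I` leaves no preimage of a vector of `dom T°` other than the canonical one, so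
-- `I⁻¹ dom T°` is just a copy of `dom T°`.
theorem exists_ofDomain_eq {y : AngularSpace hM hκ hτ}
    (hy : angularEmbed hM hκ hτ y ∈ M.toOperator.domain) :
    ∃ (x : M.T11.domain) (w : M.T22.domain),
      y = WithLp.toLp 2 (ofDomain₁ hM hκ hτ x, ofDomain₂ hM hτ w) := by
  exact ⟨⟨_, hy.1⟩, ⟨_, hy.2⟩,
    angularEmbed_injective hM hκ hτ (angularEmbed_toLp ⟨_, hy.1⟩ ⟨_, hy.2⟩).symm⟩

/-- Entry by entry, the representations of `T11`, `T12`, `T22` and the defining property of `K` for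
`T21` add up to the block operator. This is what makes `I* T° I` bounded. -/
theorem inner_toOperator_eq (hK : IsCoupling K) (y : AngularSpace hM hκ hτ)
    (hy : angularEmbed hM hκ hτ y ∈ M.toOperator.domain) (z : AngularSpace hM hκ hτ) :
    ⟪angularEmbed hM hκ hτ z, M.toOperator ⟨angularEmbed hM hκ hτ y, hy⟩⟫_ℂ =
      ⟪z, angularOperator K y⟫_ℂ := by
  obtain ⟨x, w, rfl⟩ := exists_ofDomain_eq hM hκ hτ hy
  have h : M.toOperator ⟨_, hy⟩ = WithLp.toLp 2 (M.T11 x + M.T12 w, M.T21 x + M.T22 w) := by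
    have hm : WithLp.toLp 2 ((x : H₁), (w : H₂)) ∈ M.toOperator.domain := ⟨x.2, w.2⟩
    rw [← toOperator_toLp x w hm]
    congr 1
    exact Subtype.ext (angularEmbed_toLp x w)
  rw [h, angularEmbed_apply, inner_angularOperator, WithLp.prod_inner_apply]
  change ⟪angularEmbed₁ hM hκ hτ z.fst, M.T11 x + M.T12 w⟫_ℂ +
    ⟪upperEmbed hM.T22 hτ z.snd, M.T21 x + M.T22 w⟫_ℂ = _
  rw [inner_add_right, inner_add_right, inner_T11_eq hK, inner_T12_eq hK, inner_T22_eq,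
    ← ContinuousLinearMap.adjoint_inner_right (upperEmbed hM.T22 hτ) _ (M.T21 x), ← hK x]
  change _ = κ * ⟪_, angularEmbed₁ hM hκ hτ (ofDomain₁ hM hκ hτ x)⟫_ℂ +
    ⟪_, ofDomain₁ hM hκ hτ x⟫_ℂ - ⟪_, K (ofDomain₁ hM hκ hτ x)⟫_ℂ + ⟪_, ofDomain₂ hM hτ w⟫_ℂ +
    (⟪_, K (ofDomain₁ hM hκ hτ x)⟫_ℂ +
      (τ * ⟪_, upperEmbed hM.T22 hτ (ofDomain₂ hM hτ w)⟫_ℂ - ⟪_, ofDomain₂ hM hτ w⟫_ℂ))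
  rw [angularEmbed₁_ofDomain₁, upperEmbed_ofDomain₂]

variable (hM hκ hτ) in
theorem dense_comap_toOperator_domain :
    Dense (M.toOperator.domain.comap (angularEmbed hM hκ hτ).toLinearMap :
      Set (AngularSpace hM hκ hτ)) := by
  intro y
  let e := (WithLp.prodContinuousLinearEquiv 2 ℂ (AngularSpace₁ hM hκ hτ)
    (AngularSpace₂ hM hτ)).symm
  change e (y.fst, y.snd) ∈ _
  -- Each domain is dense in its completion, so the approximation is made one coordinate at a time.
  refine FormCompletion.induction_ofDomain (P := fun y₁ => e (y₁, y.snd) ∈ _) _ _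
    (isClosed_closure.preimage (by fun_prop)) (fun x => ?_) y.fst
  refine FormCompletion.induction_ofDomain (P := fun y₂ => e (_, y₂) ∈ _) _ _
    (isClosed_closure.preimage (by fun_prop)) (fun w => subset_closure ?_) y.snd
  change angularEmbed hM hκ hτ (WithLp.toLp 2 (ofDomain₁ hM hκ hτ x, ofDomain₂ hM hτ w)) ∈
    M.toOperator.domain
  rw [angularEmbed_toLp]
  exact ⟨x.2, w.2⟩

/-- Replaces the closure in the definition of `T•` by a weak equation on all of `D`, the form in
which symmetry and surjectivity are checked. -/
theorem mem_angularExtension_graph_iff_inner (hK : IsCoupling K)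
    (u : WithLp 2 (H₁ × H₂) × WithLp 2 (H₁ × H₂)) :
    u ∈ (angularExtension hM hκ hτ).graph ↔
      ∃ y : AngularSpace hM hκ hτ, angularEmbed hM hκ hτ y = u.1 ∧
        ∀ z, ⟪z, angularOperator K y⟫_ℂ = ⟪angularEmbed hM hκ hτ z, u.2⟫_ℂ :=
  mem_riggedExtension_graph_iff (angularEmbed_injective hM hκ hτ)
    (angularEmbed_denseRange hM hκ hτ) _ (dense_comap_toOperator_domain hM hκ hτ)
    (inner_toOperator_eq hK) u

end Coupling

/-! ### Self-adjointness of the angular extension. -/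

variable [CompleteSpace H₁] (hM : M.IsSymmetric) (hκ : IsLowerShift M.T11 κ) (hτ : IsUpperShift M.T22 τ)

theorem toOperator_le_angularExtension : M.toOperator ≤ angularExtension hM hκ hτ := by
  obtain ⟨K, hK⟩ := exists_coupling hM hκ hτ
  refine LinearPMap.le_of_le_graph fun u hu => ?_
  obtain ⟨v, hv1, hv2⟩ := (LinearPMap.mem_graph_iff _).1 hu
  rw [mem_angularExtension_graph_iff_inner hK]
  have hv : angularEmbed hM hκ hτ (WithLp.toLp 2
      (ofDomain₁ hM hκ hτ ⟨_, v.2.1⟩, ofDomain₂ hM hτ ⟨_, v.2.2⟩)) = v :=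
    angularEmbed_toLp _ _
  refine ⟨_, hv.trans hv1, fun z => ?_⟩
  rw [← inner_toOperator_eq hK _ (by rw [hv]; exact v.2), ← hv2]
  congr 2
  exact Subtype.ext hv

/-- Density is inherited from `dom T°`. Symmetry is inherited from the block operator: for `u = I y`
and `v = I z`, testing each weak equation against the other vector gives `⟪T• u, v⟫ = ⟪Ψ y, z⟫` and
`⟪u, T• v⟫ = ⟪y, Ψ z⟫`, where `Ψ` is `angularOperator K`. -/
theorem isSymmetricOperator_angularExtension :
    IsSymmetricOperator (angularExtension hM hκ hτ) := by
  refine ⟨hM.1.mono (toOperator_le_angularExtension hM hκ hτ).1, fun u v => ?_⟩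
  obtain ⟨K, hK⟩ := exists_coupling hM hκ hτ
  obtain ⟨y, hy1, hy2⟩ := (mem_angularExtension_graph_iff_inner hK _).1
    ((angularExtension hM hκ hτ).mem_graph u)
  obtain ⟨z, hz1, hz2⟩ := (mem_angularExtension_graph_iff_inner hK _).1
    ((angularExtension hM hκ hτ).mem_graph v)
  dsimp only at hy1 hy2 hz1 hz2
  rw [← hy1, ← hz1, ← hz2, ← inner_conj_symm, hz1, ← hz1, ← hy2, inner_conj_symm,
    angularOperator_symm]

/-- `T• - (ϰ ⊕ τ)` is surjective: its Schur complement is the Riesz isomorphism of `D₁`. -/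
theorem surjective_angularExtension_sub (a : WithLp 2 (H₁ × H₂)) :
    ∃ x : (angularExtension hM hκ hτ).domain,
      angularExtension hM hκ hτ x = a + diagonalShift H₁ H₂ κ τ x := by
  obtain ⟨K, hK⟩ := exists_coupling hM hκ hτ
  let I₁ := angularEmbed₁ hM hκ hτ
  let I₂ := upperEmbed hM.T22 hτ
  -- Block elimination in the system `(1 - K†K) y₁ + K† y₂ = I₁† a₁`, `K y₁ - y₂ = I₂† a₂`. The
  -- second row gives `y₂ = K y₁ - I₂† a₂`; inserted in the first, it cancels `K†K y₁` and leaves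
  -- `y₁` alone.
  let y₁ := I₁.adjoint a.fst + K.adjoint (I₂.adjoint a.snd)
  let y : AngularSpace hM hκ hτ := WithLp.toLp 2 (y₁, K y₁ - I₂.adjoint a.snd)
  have hm : (angularEmbed hM hκ hτ y, a + diagonalShift H₁ H₂ κ τ (angularEmbed hM hκ hτ y)) ∈
      (angularExtension hM hκ hτ).graph := by
    refine (mem_angularExtension_graph_iff_inner hK _).2 ⟨y, rfl, fun z => ?_⟩
    have h1 : ⟪z.fst, y₁⟫_ℂ = ⟪I₁ z.fst, a.fst⟫_ℂ + ⟪K z.fst, I₂.adjoint a.snd⟫_ℂ := by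
      rw [inner_add_right, ContinuousLinearMap.adjoint_inner_right,
        ContinuousLinearMap.adjoint_inner_right]
    have h2 : ⟪z.snd, I₂.adjoint a.snd⟫_ℂ = ⟪I₂ z.snd, a.snd⟫_ℂ :=
      ContinuousLinearMap.adjoint_inner_right _ _ _
    have h3 : ⟪K z.fst, y.snd⟫_ℂ = ⟪K z.fst, K y₁⟫_ℂ - ⟪K z.fst, I₂.adjoint a.snd⟫_ℂ :=
      inner_sub_right _ _ _
    have h4 : ⟪z.snd, y.snd⟫_ℂ = ⟪z.snd, K y₁⟫_ℂ - ⟪z.snd, I₂.adjoint a.snd⟫_ℂ :=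
      inner_sub_right _ _ _
    have h5 : ⟪angularEmbed hM hκ hτ z, a⟫_ℂ = ⟪I₁ z.fst, a.fst⟫_ℂ + ⟪I₂ z.snd, a.snd⟫_ℂ :=
      WithLp.prod_inner_apply _ _
    have h6 : ⟪angularEmbed hM hκ hτ z, diagonalShift H₁ H₂ κ τ (angularEmbed hM hκ hτ y)⟫_ℂ =
        κ * ⟪I₁ z.fst, I₁ y₁⟫_ℂ + τ * ⟪I₂ z.snd, I₂ y.snd⟫_ℂ := inner_diagonalShift _ _ _ _
    rw [inner_angularOperator, inner_add_right, h3, h4, h5, h6]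
    change κ * ⟪I₁ z.fst, I₁ y₁⟫_ℂ + ⟪z.fst, y₁⟫_ℂ - ⟪K z.fst, K y₁⟫_ℂ + _ +
      (⟪z.snd, K y₁⟫_ℂ + (τ * ⟪I₂ z.snd, I₂ y.snd⟫_ℂ - _)) = _
    -- The shift terms and all terms in `K y₁` cancel; only the defining equation of `y₁` and the
    -- adjoint relation for `I₂` remain.
    linear_combination h1 + h2
  obtain ⟨x, hx1, hx2⟩ := (LinearPMap.mem_graph_iff _).1 hm
  dsimp only at hx1 hx2
  exact ⟨x, by rw [hx2, hx1]⟩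

/-- The angular extension is self-adjoint. -/
theorem adjoint_angularExtension :
    (angularExtension hM hκ hτ).adjoint = angularExtension hM hκ hτ :=
  adjoint_eq_of_surjective_sub (isSymmetricOperator_angularExtension hM hκ hτ) _
    (diagonalShift_symm κ τ) (surjective_angularExtension_sub hM hκ hτ)

end OperatorMatrix

end

/-! ### Identification of the closure with the angular extension. -/

theorem mainTheorem8 {H₁ H₂ : Type*}
    [NormedAddCommGroup H₁] [InnerProductSpace ℂ H₁] [CompleteSpace H₁]
    [NormedAddCommGroup H₂] [InnerProductSpace ℂ H₂] [CompleteSpace H₂]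
    (M : OperatorMatrix H₁ H₂) (hM : M.IsSymmetric)
    (hess : IsEssentiallySelfAdjoint M.toOperator)
    (h11 : IsBoundedBelow M.T11) (h22 : IsBoundedAbove M.T22)
    (hdom :
      (IsEssentiallySelfAdjoint M.T22 ∧
        ∃ γ κ : ℝ, ∀ y : M.T11.domain,
          ‖M.T21 y‖ ^ 2 ≤ γ * (inner ℂ (M.T11 y - (κ : ℂ) • (y : H₁)) (y : H₁)).re) ∨
      (∃ γ κ τ : ℝ,
        (∀ y : M.T11.domain,
          ‖M.T21 y‖ ^ 2 ≤ γ * (inner ℂ (M.T11 y - (κ : ℂ) • (y : H₁)) (y : H₁)).re) ∧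
        (∀ y : M.T22.domain,
          ‖M.T12 y‖ ^ 2 ≤ γ * (inner ℂ ((τ : ℂ) • (y : H₂) - M.T22 y) (y : H₂)).re)) ∨
      (IsBoundedOperator M.T11 ∧ IsBoundedOperator M.T22)) :
    ∀ (κ τ : ℝ) (hκ : IsLowerShift M.T11 κ) (hτ : IsUpperShift M.T22 τ),
      M.toOperator.closure = OperatorMatrix.angularExtension hM hκ hτ := by
  intro κ τ hκ hτ
  exact hess.closure_eq (OperatorMatrix.toOperator_le_angularExtension hM hκ hτ)
    (OperatorMatrix.isSymmetricOperator_angularExtension hM hκ hτ).1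
    (OperatorMatrix.adjoint_angularExtension hM hκ hτ)
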